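/- Let $R$ be a two-dimensional (Noetherian) regular local ring with maximal ideal $\mathfrak m$. A valuation on $R$ with values in $\mathbb R_\infty=\mathbb R\cup\{\infty\}$ is a map $\nu:R\to\mathbb R_\infty$ with $\nu(\phi\psi)=\nu(\phi)+\nu(\psi)$ and $\nu(\phi+\psi)\ge\min\{\nu(\phi),\nu(\psi)\}$ for all $\phi,\psi\in R$, $\nu(1)=0$ and $\nu(0)=\infty$ (the value $\infty$ may also be taken at non-zero elements). It is centered if $\nu\ge 0$ on $R$ and $\nu>0$ on $\mathfrak m$, and it is normalized by $1$ if $\nu(\mathfrak m):=\min\{\nu(\phi)\mid\phi\in\mathfrak m\}=1$. Let $\mathcal W_{\mathfrak m}$ (the valuative tree of $R$) be the set of all centered valuations $\nu:R\to\mathbb R_\infty$ normalized by $1$, partially ordered by $\nu\le\mu$ if and only if $\nu(\phi)\le\mu(\phi)$ for every $\phi\in R$. Then every non-empty subset $\mathcal S\subseteq\mathcal W_{\mathfrak m}$ has an infimum in $\mathcal W_{\mathfrak m}$: there is a valuation $\nu\in\mathcal W_{\mathfrak m}$ such that $\nu\le\mu$ for all $\mu\in\mathcal S$, and $\nu'\le\nu$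 for every $\nu'\in\mathcal W_{\mathfrak m}$ with $\nu'\le\mu$ for all $\mu\in\mathcal S$. -/

import Mathlib

open IsLocalRing

/-- Valuations `ν : R → ℝ ∪ {∞}`: `ν (φ * ψ) = ν φ + ν ψ`, `min (ν φ) (ν ψ) ≤ ν (φ + ψ)`,
`ν 1 = 0` and `ν 0 = ∞`; the value `∞` may also be taken at nonzero elements. -/
abbrev RealValuation (R : Type*) [CommRing R] : Type _ := AddValuation R (WithTop ℝ)

namespace RealValuation

variable {R : Type*} [CommRing R] [IsLocalRing R]

/-- `ν` is centered: nonnegative on `R` and positive on the maximal ideal. -/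
def IsCentered (ν : RealValuation R) : Prop :=
  (∀ φ : R, 0 ≤ ν φ) ∧ ∀ φ ∈ maximalIdeal R, 0 < ν φ

/-- `ν` is normalized by `γ`: the minimum of `ν` on the maximal ideal exists and equals `γ`. -/
def IsNormalizedBy (ν : RealValuation R) (γ : ℝ) : Prop :=
  IsLeast {a : WithTop ℝ | ∃ φ ∈ maximalIdeal R, ν φ = a} (γ : WithTop ℝ)

end RealValuation

/-- The valuative tree of a local ring `R`: the centered valuations `R → ℝ ∪ {∞}`
normalized by `1`. -/
def ValuativeTree (R : Type*) [CommRing R] [IsLocalRing R] : Type _ :=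
  {ν : RealValuation R // ν.IsCentered ∧ ν.IsNormalizedBy 1}

/-- The pointwise order on the valuative tree. -/
instance (R : Type*) [CommRing R] [IsLocalRing R] : PartialOrder (ValuativeTree R) where
  le ν μ := ∀ φ : R, ν.1 φ ≤ μ.1 φ
  le_refl _ _ := le_rfl
  le_trans _ _ _ h₁ h₂ φ := (h₁ φ).trans (h₂ φ)
  le_antisymm _ _ h₁ h₂ := Subtype.ext (AddValuation.ext fun φ => le_antisymm (h₁ φ) (h₂ φ))

/-!
Why infima exist: the lower bounds of `S` form a chain, and their pointwise supremum is again a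
valuation.

* Lower bounds exist because the `𝔪`-adic order is a valuation lying below every element of the
  tree. Its multiplicativity (`mul_notMem_maximalIdeal_pow`) says that the associated graded ring is
  a domain. It is proved with a regular system of parameters `x`, `y`, after showing that `R` is a
  domain and that `x` is prime.
* The pointwise supremum of a chain bounded above is a valuation in the tree
  (`ValuativeTree.exists_isLUB_of_isChain`).
* Two elements `ν₁`, `ν₂` below a common `μ` are comparable (`ValuativeTree.le_total_of_le`). This
  is the heart of the proof, and follows the method of key polynomials without passing to the
  completion of `R`. Choose `x ∈ 𝔪` with `μ x = 1`; then `ν₁ x = ν₂ x = 1` as well, and `x` is a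
  regular parameter. The order of an element in the discrete valuation ring `R / (x)` plays the role
  of the degree. Take `φ` of least degree at which one of `ν₁`, `ν₂`, say `ν₁`, is smaller than `μ`.
  Division by `φ` writes `f = q φ + r` with `r` a power of `x` times an element of smaller degree,
  hence with `ν₁ r = ν₂ r = μ r`, or with `r` divisible by a prescribed power of `x` and therefore
  negligible. The failure of `ν₁` to reach `μ` at `φ` forbids cancellation, so that
  `ν₁ f = min (ν₁ (q φ)) (ν₁ r)`. If `ν₁ φ ≤ ν₂ φ`, repeating this for `q` gives `ν₁ ≤ ν₂`.
  Otherwise `ν₂ φ < ν₁ φ < μ φ`, and the roles of `ν₁` and `ν₂` may be exchanged.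
-/

/-! ### Two-dimensional regular local rings -/

section LocalRing

variable {R : Type*} [CommRing R]

/-- `f` agrees modulo `x` with a unit times `y ^ n`. When the maximal ideal is generated by `x` and
`y` and no power of `y` is divisible by `x`, this says that the image of `f` in the discrete
valuation ring `R / (x)` has order `n`; it replaces the degree of a polynomial. -/
def HasResidualOrder (x y : R) (n : ℕ) (f : R) : Prop :=
  ∃ u, IsUnit u ∧ ∃ z, f = u * y ^ n + x * z

theorem HasResidualOrder.mul {x y f g : R} {m n : ℕ} (hf : HasResidualOrder x y m f)
    (hg : HasResidualOrder x y n g) : HasResidualOrder x y (m + n) (f * g) := by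
  obtain ⟨u, hu, z, rfl⟩ := hf
  obtain ⟨v, hv, w, rfl⟩ := hg
  exact ⟨u * v, hu.mul hv, u * y ^ m * w + z * (v * y ^ n) + x * z * w, by ring⟩

theorem HasResidualOrder.not_dvd {x y f : R} {n : ℕ} (hy : ∀ n, ¬ x ∣ y ^ n)
    (hf : HasResidualOrder x y n f) : ¬ x ∣ f := by
  obtain ⟨u, hu, z, rfl⟩ := hf
  intro h
  exact hy n (hu.dvd_mul_left.mp ((dvd_add_left (dvd_mul_right x z)).mp h))

variable [IsLocalRing R] {x y : R}

theorem exists_maximalIdeal_eq_span_pair [IsNoetherianRing R]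
    (h2 : (maximalIdeal R).spanFinrank = 2) (hx : x ∈ maximalIdeal R)
    (hx2 : x ∉ maximalIdeal R ^ 2) : ∃ y, maximalIdeal R = Ideal.span {x, y} := by
  have fg := (maximalIdeal R).fg_of_isNoetherianRing
  have hc := Submodule.FG.generators_ncard fg
  rw [h2, Set.ncard_eq_two] at hc
  obtain ⟨a, b, -, hab⟩ := hc
  have hspan : maximalIdeal R = Ideal.span {a, b} := by
    rw [← hab]; exact ((maximalIdeal R).span_generators).symm
  -- A coefficient of `x` on a minimal generator must be a unit, since `x` is not in `m ^ 2`.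
  have key : ∀ {a b : R}, maximalIdeal R = Ideal.span {a, b} → ∀ {r s : R}, r * a + s * b = x →
      IsUnit r → maximalIdeal R = Ideal.span {x, b} := by
    intro a b hspan r s hrs hr
    have ha : a ∈ Ideal.span {x, b} := by
      obtain ⟨r', hr'⟩ := hr.exists_left_inv
      refine Ideal.mem_span_pair.mpr ⟨r', -(r' * s), ?_⟩
      linear_combination a * hr' - r' * hrs
    apply le_antisymm
    · rw [hspan, Ideal.span_le, Set.insert_subset_iff, Set.singleton_subset_iff]
      exact ⟨ha, Ideal.subset_span (by simp)⟩
    · rw [Ideal.span_le, Set.insert_subset_iff, Set.singleton_subset_iff]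
      exact ⟨hx, hspan ▸ Ideal.subset_span (by simp)⟩
  obtain ⟨r, s, hrs⟩ := Ideal.mem_span_pair.mp (hspan ▸ hx)
  by_cases hr : IsUnit r
  · exact ⟨b, key hspan hrs hr⟩
  by_cases hs : IsUnit s
  · exact ⟨a, key (hspan.trans (by rw [Set.pair_comm])) (by rw [add_comm]; exact hrs) hs⟩
  refine absurd ?_ hx2
  have ha : a ∈ maximalIdeal R := hspan ▸ Ideal.subset_span (by simp)
  have hb : b ∈ maximalIdeal R := hspan ▸ Ideal.subset_span (by simp)
  rw [← hrs, pow_two]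
  exact add_mem (Ideal.mul_mem_mul ((mem_maximalIdeal r).mpr hr) ha)
    (Ideal.mul_mem_mul ((mem_maximalIdeal s).mpr hs) hb)

/-- By Krull's principal ideal theorem, a maximal ideal of height at least two is not the radical
of a principal ideal. -/
theorem not_dvd_pow_of_height [IsNoetherianRing R] (h2 : 1 < (maximalIdeal R).height)
    (hm : maximalIdeal R = Ideal.span {x, y}) (n : ℕ) : ¬ x ∣ y ^ n := by
  intro h
  refine h2.not_ge (Ideal.height_le_one_of_isPrincipal_of_mem_minimalPrimes (Ideal.span {x}) _ ?_)
  refine ⟨⟨(maximalIdeal.isMaximal R).isPrime, ?_⟩, ?_⟩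
  · rw [hm]; exact Ideal.span_mono (by simp)
  · rintro p ⟨hp, hxp⟩ -
    have hx : x ∈ p := hxp (Ideal.mem_span_singleton_self x)
    rw [hm, Ideal.span_le, Set.insert_subset_iff, Set.singleton_subset_iff]
    exact ⟨hx, hp.mem_of_pow_mem n (p.mem_of_dvd h hx)⟩

/-- Every element not divisible by `x` has a residual order; this is Krull's intersection theorem
in `R / (x)`, whose maximal ideal is generated by `y`. -/
theorem exists_hasResidualOrder [IsNoetherianRing R]
    (hm : maximalIdeal R = Ideal.span {x, y}) {f : R} (hf : ¬ x ∣ f) :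
    ∃ n, HasResidualOrder x y n f := by
  by_contra! H
  have step : ∀ n, ∃ c z, f = c * y ^ n + x * z := by
    intro n
    induction n with
    | zero => exact ⟨f, 0, by ring⟩
    | succ n ih =>
      obtain ⟨c, z, hc⟩ := ih
      have hcu : ¬ IsUnit c := fun hu => H n ⟨c, hu, z, hc⟩
      have hcm : c ∈ maximalIdeal R := hcu
      rw [hm] at hcm
      obtain ⟨a, b, rfl⟩ := Ideal.mem_span_pair.mp hcm
      exact ⟨b, a * y ^ n + z, by rw [hc]; ring⟩
  have hy : y ∈ maximalIdeal R := hm ▸ Ideal.subset_span (by simp)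
  have hbot := Ideal.iInf_pow_smul_eq_bot_of_isLocalRing (M := R ⧸ Ideal.span {x})
    (maximalIdeal R) (maximalIdeal.isMaximal R).ne_top
  have hmem : (Ideal.Quotient.mk (Ideal.span {x}) f) ∈
      (⨅ i, maximalIdeal R ^ i • (⊤ : Submodule R (R ⧸ Ideal.span {x}))) := by
    rw [Submodule.mem_iInf]
    intro n
    obtain ⟨c, z, hc⟩ := step n
    have : Ideal.Quotient.mk (Ideal.span {x}) f =
        y ^ n • Ideal.Quotient.mk (Ideal.span {x}) c := by
      rw [Algebra.smul_def, Ideal.Quotient.algebraMap_eq, ← map_mul,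
        Ideal.Quotient.mk_eq_mk_iff_sub_mem, Ideal.mem_span_singleton]
      exact ⟨z, by rw [hc]; ring⟩
    rw [this]
    exact Submodule.smul_mem_smul (Ideal.pow_mem_pow hy n) trivial
  rw [hbot, Submodule.mem_bot, Ideal.Quotient.eq_zero_iff_mem, Ideal.mem_span_singleton] at hmem
  exact hf hmem

theorem isPrime_span_singleton [IsNoetherianRing R]
    (hm : maximalIdeal R = Ideal.span {x, y}) (hy : ∀ n, ¬ x ∣ y ^ n) :
    (Ideal.span {x}).IsPrime := by
  refine Ideal.isPrime_iff.mpr ⟨fun h => hy 0 ?_, fun {a b} hab => ?_⟩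
  · rw [← Ideal.mem_span_singleton, h]; trivial
  · simp only [Ideal.mem_span_singleton] at hab ⊢
    by_contra! H
    obtain ⟨m, hm'⟩ := exists_hasResidualOrder hm H.1
    obtain ⟨n, hn⟩ := exists_hasResidualOrder hm H.2
    exact (hm'.mul hn).not_dvd hy hab

/-- A Noetherian local ring of dimension at least two whose maximal ideal is generated by two
elements is a domain. The ideals `(x + y ^ (n + 1))` are prime and pairwise distinct, so one of them
is not among the finitely many minimal primes; a prime `p` strictly contained in it satisfies
`p = (x + y ^ (n + 1)) p` and vanishes by Nakayama's lemma. -/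
theorem isDomain_of_maximalIdeal_eq_span_pair [IsNoetherianRing R]
    (h2 : 1 < (maximalIdeal R).height) (hm : maximalIdeal R = Ideal.span {x, y}) :
    IsDomain R := by
  have hgen : ∀ n : ℕ, maximalIdeal R = Ideal.span {x + y ^ (n + 1), y} := by
    intro n
    rw [hm, pow_succ]
    simp
  have hprime : ∀ n : ℕ, (Ideal.span {x + y ^ (n + 1)}).IsPrime := fun n =>
    isPrime_span_singleton (hgen n) (not_dvd_pow_of_height h2 (hgen n))
  have hymem : y ∈ maximalIdeal R := hm ▸ Ideal.subset_span (by simp)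
  obtain ⟨n, hn⟩ : ∃ n : ℕ, Ideal.span {x + y ^ (n + 1)} ∉ minimalPrimes R := by
    by_contra! H
    obtain ⟨i, j, hij, he⟩ := Set.Finite.exists_lt_map_eq_of_forall_mem H
      (minimalPrimes.finite_of_isNoetherianRing R)
    have hd : x + y ^ (i + 1) ∣ x + y ^ (j + 1) :=
      Ideal.span_singleton_le_span_singleton.mp he.symm.le
    have hd' : x + y ^ (i + 1) ∣ (1 - y ^ (j - i)) * y ^ (i + 1) := by
      have : (1 - y ^ (j - i)) * y ^ (i + 1) = (x + y ^ (i + 1)) - (x + y ^ (j + 1)) := by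
        have : j + 1 = (j - i) + (i + 1) := by omega
        rw [this, pow_add]; ring
      rw [this]
      exact dvd_sub dvd_rfl hd
    have hu : IsUnit (1 - y ^ (j - i)) := by
      by_contra hnu
      exact hnu (isUnit_one_sub_self_of_mem_nonunits _
        (Ideal.pow_mem_of_mem _ hymem _ (by omega)))
    exact not_dvd_pow_of_height h2 (hgen i) (i + 1) (hu.dvd_mul_left.mp hd')
  set w := x + y ^ (n + 1) with hw
  have := hprime n
  obtain ⟨p, hp, hpw⟩ := Ideal.exists_minimalPrimes_le (bot_le : (⊥ : Ideal R) ≤ Ideal.span {w})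
  have hpp : p.IsPrime := hp.1.1
  have hwp : w ∉ p := by
    intro h
    exact hn ((le_antisymm hpw ((Ideal.span_singleton_le_iff_mem p).mpr h)) ▸ hp)
  have hpbot : p = ⊥ := by
    refine Submodule.eq_bot_of_le_smul_of_le_jacobson_bot (maximalIdeal R) p
      p.fg_of_isNoetherianRing ?_ (maximalIdeal_le_jacobson ⊥)
    intro z hz
    obtain ⟨t, rfl⟩ := Ideal.mem_span_singleton.mp (hpw hz)
    exact Ideal.mul_mem_mul ((hgen n).symm ▸ Ideal.subset_span (Set.mem_insert _ _))
      ((hpp.mem_or_mem hz).resolve_left hwp)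
  rw [hpbot] at hpp
  exact IsDomain.of_bot_isPrime R

/-! ### The order function of the maximal ideal -/

theorem exists_eq_of_mem_maximalIdeal_pow_succ (hm : maximalIdeal R = Ideal.span {x, y}) (n : ℕ)
    {f : R} (hf : f ∈ maximalIdeal R ^ (n + 1)) :
    ∃ h ∈ maximalIdeal R ^ n, ∃ c, f = x * h + c * y ^ (n + 1) := by
  induction n generalizing f with
  | zero =>
    rw [zero_add, pow_one, hm] at hf
    obtain ⟨a, b, rfl⟩ := Ideal.mem_span_pair.mp hf
    exact ⟨a, by simp, b, by ring⟩
  | succ n ih =>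
    have hy : y ∈ maximalIdeal R := hm ▸ Ideal.subset_span (by simp)
    rw [pow_succ] at hf
    induction hf using Submodule.mul_induction_on' with
    | mem_mul_mem p hp q hq =>
      rw [hm] at hq
      obtain ⟨a, b, rfl⟩ := Ideal.mem_span_pair.mp hq
      obtain ⟨h, hh, c, hc⟩ := ih hp
      refine ⟨p * a + b * (h * y), add_mem (Ideal.mul_mem_right _ _ hp)
        (Ideal.mul_mem_left _ _ ?_), b * c, ?_⟩
      · rw [pow_succ]; exact Ideal.mul_mem_mul hh hy
      · linear_combination b * y * hc
    | add p _ q _ hp hq =>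
      obtain ⟨h, hh, c, rfl⟩ := hp
      obtain ⟨h', hh', c', rfl⟩ := hq
      exact ⟨h + h', add_mem hh hh', c + c', by ring⟩

/-- The colon ideal `m ^ (n + 1) : x` is `m ^ n`. -/
theorem mem_maximalIdeal_pow_of_mul_mem (hm : maximalIdeal R = Ideal.span {x, y})
    (hy : ∀ n, ¬ x ∣ y ^ n) [IsDomain R] (hx : Prime x) (n : ℕ) {z : R}
    (hz : x * z ∈ maximalIdeal R ^ (n + 1)) : z ∈ maximalIdeal R ^ n := by
  obtain ⟨h, hh, c, hc⟩ := exists_eq_of_mem_maximalIdeal_pow_succ hm n hz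
  have hd : x ∣ c * y ^ (n + 1) := ⟨z - h, by linear_combination -hc⟩
  obtain ⟨c', rfl⟩ := (hx.dvd_or_dvd hd).resolve_right (hy _)
  have : z = h + c' * y ^ (n + 1) := mul_left_cancel₀ hx.ne_zero (by rw [hc]; ring)
  rw [this]
  have hym : y ∈ maximalIdeal R := hm ▸ Ideal.subset_span (by simp)
  exact add_mem hh (Ideal.mul_mem_left _ _
    (Ideal.pow_le_pow_right n.le_succ (Ideal.pow_mem_pow hym _)))

theorem mem_maximalIdeal_pow_of_pow_mul_mem (hm : maximalIdeal R = Ideal.span {x, y})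
    (hy : ∀ n, ¬ x ∣ y ^ n) [IsDomain R] (hx : Prime x) (n i : ℕ) {z : R}
    (hz : x ^ i * z ∈ maximalIdeal R ^ (n + i)) : z ∈ maximalIdeal R ^ n := by
  induction i with
  | zero => simpa using hz
  | succ i ih =>
    refine ih (mem_maximalIdeal_pow_of_mul_mem hm hy hx (n + i) ?_)
    rwa [← mul_assoc, ← pow_succ']

theorem HasResidualOrder.notMem_pow {n : ℕ} {f : R} (hf : HasResidualOrder x y n f)
    (hm : maximalIdeal R = Ideal.span {x, y}) (hy : ∀ n, ¬ x ∣ y ^ n) :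
    f ∉ maximalIdeal R ^ (n + 1) := by
  intro h
  obtain ⟨p, -, c, hc⟩ := exists_eq_of_mem_maximalIdeal_pow_succ hm n h
  obtain ⟨u, hu, z, rfl⟩ := hf
  have hym : y ∈ maximalIdeal R := hm ▸ Ideal.subset_span (by simp)
  have hv : IsUnit (u - c * y) := by
    by_contra hnu
    have h1 : u - c * y ∈ maximalIdeal R := hnu
    have h2 : u ∈ maximalIdeal R := by
      simpa using add_mem h1 (Ideal.mul_mem_left _ c hym)
    exact h2 hu
  refine hy n (hv.dvd_mul_left.mp ⟨p - z, ?_⟩)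
  linear_combination hc

/-- The part of the degree `n` initial form of `f` that remains after dividing it by the largest
possible power `x ^ i` has a nonzero pure power of `y`. -/
theorem exists_leading_factor (hm : maximalIdeal R = Ideal.span {x, y}) (n : ℕ) {f : R}
    (hf : f ∈ maximalIdeal R ^ n) (hf' : f ∉ maximalIdeal R ^ (n + 1)) :
    ∃ i j g, i + j = n ∧ HasResidualOrder x y j g ∧ f - x ^ i * g ∈ maximalIdeal R ^ (n + 1) := by
  induction n generalizing f with
  | zero =>
    refine ⟨0, 0, f, rfl, ⟨f, ?_, 0, by ring⟩, by simp⟩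
    by_contra hnu
    exact hf' (by simpa using hnu)
  | succ n ih =>
    obtain ⟨h, hh, c, rfl⟩ := exists_eq_of_mem_maximalIdeal_pow_succ hm n hf
    have hym : y ∈ maximalIdeal R := hm ▸ Ideal.subset_span (by simp)
    have hxm : x ∈ maximalIdeal R := hm ▸ Ideal.subset_span (by simp)
    by_cases hc : IsUnit c
    · exact ⟨0, n + 1, _, by omega, ⟨c, hc, h, add_comm _ _⟩, by simp⟩
    · have hcy : c * y ^ (n + 1) ∈ maximalIdeal R ^ (n + 1 + 1) := by
        rw [pow_succ' _ (n + 1)]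
        exact Ideal.mul_mem_mul hc (Ideal.pow_mem_pow hym _)
      have hx1 : ∀ {z}, z ∈ maximalIdeal R ^ (n + 1) → x * z ∈ maximalIdeal R ^ (n + 1 + 1) := by
        intro z hz
        rw [pow_succ' _ (n + 1)]
        exact Ideal.mul_mem_mul hxm hz
      obtain ⟨i, j, g, hij, hg, hfg⟩ := ih hh (fun h' => hf' (add_mem (hx1 h') hcy))
      refine ⟨i + 1, j, g, by omega, hg, ?_⟩
      have : x * h + c * y ^ (n + 1) - x ^ (i + 1) * g =
          x * (h - x ^ i * g) + c * y ^ (n + 1) := by ring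
      rw [this]
      exact add_mem (hx1 hfg) hcy

/-- The associated graded ring of the maximal ideal is a domain. -/
theorem mul_notMem_maximalIdeal_pow (hm : maximalIdeal R = Ideal.span {x, y})
    (hy : ∀ n, ¬ x ∣ y ^ n) [IsDomain R] (hx : Prime x) {a b : ℕ} {f g : R}
    (hf : f ∈ maximalIdeal R ^ a) (hf' : f ∉ maximalIdeal R ^ (a + 1))
    (hg : g ∈ maximalIdeal R ^ b) (hg' : g ∉ maximalIdeal R ^ (b + 1)) :
    f * g ∉ maximalIdeal R ^ (a + b + 1) := by
  intro hfg
  obtain ⟨i, j, f₁, hij, hf₁, hff⟩ := exists_leading_factor hm a hf hf'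
  obtain ⟨k, l, g₁, hkl, hg₁, hgg⟩ := exists_leading_factor hm b hg hg'
  have hxm : x ∈ maximalIdeal R := hm ▸ Ideal.subset_span (by simp)
  have h1 : f * (g - x ^ k * g₁) ∈ maximalIdeal R ^ (a + b + 1) := by
    rw [add_assoc, pow_add]; exact Ideal.mul_mem_mul hf hgg
  have hg2 : x ^ k * g₁ ∈ maximalIdeal R ^ b := by
    have := sub_mem hg (Ideal.pow_le_pow_right b.le_succ hgg)
    simpa using this
  have h2 : (f - x ^ i * f₁) * (x ^ k * g₁) ∈ maximalIdeal R ^ (a + b + 1) := by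
    rw [show a + b + 1 = (a + 1) + b by omega, pow_add]; exact Ideal.mul_mem_mul hff hg2
  refine (hf₁.mul hg₁).notMem_pow hm hy
    (mem_maximalIdeal_pow_of_pow_mul_mem hm hy hx (j + l + 1) (i + k) ?_)
  have : x ^ (i + k) * (f₁ * g₁) =
      f * g - f * (g - x ^ k * g₁) - (f - x ^ i * f₁) * (x ^ k * g₁) := by ring
  rw [this, show j + l + 1 + (i + k) = a + b + 1 by omega]
  exact sub_mem (sub_mem hfg h1) h2

end LocalRing

/-! ### The order valuation -/

section OrderValuation

variable {R : Type*} [CommRing R] [IsLocalRing R] {x y : R}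

/-- The `𝔪`-adic order of `f`, the supremum of all `n` with `f ∈ 𝔪 ^ n`. -/
noncomputable def maximalIdealOrder (f : R) : ℕ∞ :=
  ⨆ n : {n : ℕ // f ∈ maximalIdeal R ^ n}, (n : ℕ∞)

theorem natCast_le_maximalIdealOrder_iff {n : ℕ} {f : R} :
    (n : ℕ∞) ≤ maximalIdealOrder f ↔ f ∈ maximalIdeal R ^ n := by
  refine ⟨fun h => ?_, fun h => le_iSup
    (fun n : {n : ℕ // f ∈ maximalIdeal R ^ n} => (n : ℕ∞)) ⟨n, h⟩⟩
  by_contra hf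
  cases n with
  | zero => simp at hf
  | succ n =>
    have : maximalIdealOrder f ≤ n := by
      refine iSup_le fun ⟨k, hk⟩ => Nat.cast_le.mpr ?_
      by_contra! hlt
      exact hf (Ideal.pow_le_pow_right hlt hk)
    have := Nat.cast_le.mp (h.trans this)
    omega

theorem maximalIdealOrder_eq_natCast {n : ℕ} {f : R} (h : f ∈ maximalIdeal R ^ n)
    (h' : f ∉ maximalIdeal R ^ (n + 1)) : maximalIdealOrder f = n := by
  refine le_antisymm ?_ (natCast_le_maximalIdealOrder_iff.mpr h)
  by_contra! hlt
  exact h' (natCast_le_maximalIdealOrder_iff.mp (by simpa using Order.add_one_le_of_lt hlt))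

/-- The `𝔪`-adic order as a valuation. -/
noncomputable def orderValuation [IsDomain R] (hm : maximalIdeal R = Ideal.span {x, y})
    (hy : ∀ n, ¬ x ∣ y ^ n) (hx : Prime x) : AddValuation R ℕ∞ :=
  AddValuation.of maximalIdealOrder
    (ENat.eq_top_iff_forall_ge.mpr fun n => natCast_le_maximalIdealOrder_iff.mpr (zero_mem _))
    (by
      have h := maximalIdealOrder_eq_natCast (R := R) (n := 0) (f := 1) (by simp)
        (by simp)
      simpa using h)
    (fun f g => by
      refine ENat.forall_natCast_le_iff_le.mp fun n hn => ?_
      rw [le_min_iff] at hn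
      simp only [natCast_le_maximalIdealOrder_iff] at hn ⊢
      exact add_mem hn.1 hn.2)
    (fun f g => by
      have htop : ∀ {f : R} (g : R), maximalIdealOrder f = ⊤ → maximalIdealOrder (f * g) = ⊤ := by
        intro f g hf
        rw [ENat.eq_top_iff_forall_ge] at hf ⊢
        exact fun n => natCast_le_maximalIdealOrder_iff.mpr
          (Ideal.mul_mem_right _ _ (natCast_le_maximalIdealOrder_iff.mp (hf n)))
      have hfin : ∀ {f : R} {n : ℕ}, maximalIdealOrder f = n →
          f ∈ maximalIdeal R ^ n ∧ f ∉ maximalIdeal R ^ (n + 1) := by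
        intro f n hf
        rw [← natCast_le_maximalIdealOrder_iff, ← natCast_le_maximalIdealOrder_iff, hf,
          Nat.cast_le, Nat.cast_le]
        omega
      cases hf : maximalIdealOrder f with
      | top => rw [htop g hf, top_add]
      | coe a =>
        cases hg : maximalIdealOrder g with
        | top => rw [mul_comm, htop f hg, add_top]
        | coe b =>
          have hfa := hfin hf
          have hgb := hfin hg
          rw [← Nat.cast_add]
          refine maximalIdealOrder_eq_natCast ?_
            (mul_notMem_maximalIdeal_pow hm hy hx hfa.1 hfa.2 hgb.1 hgb.2)
          rw [pow_add]
          exact Ideal.mul_mem_mul hfa.1 hgb.1)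

end OrderValuation

namespace RealValuation

variable {R : Type*} [CommRing R] [IsLocalRing R]

theorem natCast_le_of_mem_pow {ν : RealValuation R} (h0 : ∀ f, 0 ≤ ν f)
    (h1 : ∀ f ∈ maximalIdeal R, 1 ≤ ν f) {n : ℕ} {f : R} (hf : f ∈ maximalIdeal R ^ n) :
    (n : WithTop ℝ) ≤ ν f := by
  induction n generalizing f with
  | zero => simpa using h0 f
  | succ n ih =>
    rw [pow_succ] at hf
    induction hf using Submodule.mul_induction_on' with
    | mem_mul_mem p hp q hq =>
      rw [ν.map_mul, Nat.cast_add, Nat.cast_one]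
      exact add_le_add (ih hp) (h1 q hq)
    | add p _ q _ hp hq => exact ν.map_le_add hp hq

end RealValuation

namespace ValuativeTree

variable {R : Type*} [CommRing R]

section

variable [IsLocalRing R]

theorem zero_le (ν : ValuativeTree R) (f : R) : 0 ≤ ν.1 f := ν.2.1.1 f

theorem one_le (ν : ValuativeTree R) {f : R} (hf : f ∈ maximalIdeal R) : 1 ≤ ν.1 f :=
  ν.2.2.2 ⟨f, hf, rfl⟩

theorem eq_zero_of_isUnit (ν : ValuativeTree R) {u : R} (hu : IsUnit u) : ν.1 u = 0 := by
  obtain ⟨v, hv⟩ := hu.exists_right_inv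
  have h : ν.1 u + ν.1 v = 0 := by rw [← ν.1.map_mul, hv, ν.1.map_one]
  refine le_antisymm ?_ (ν.zero_le u)
  calc ν.1 u ≤ ν.1 u + ν.1 v := le_add_of_nonneg_right (ν.zero_le v)
    _ = 0 := h

theorem exists_eq_one (ν : ValuativeTree R) : ∃ x ∈ maximalIdeal R, ν.1 x = 1 := ν.2.2.1

theorem notMem_sq (ν : ValuativeTree R) {x : R} (h : ν.1 x = 1) : x ∉ maximalIdeal R ^ 2 := by
  intro hx
  have := RealValuation.natCast_le_of_mem_pow ν.zero_le (fun f hf => ν.one_le hf) hx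
  rw [h] at this
  exact absurd (WithTop.coe_le_coe.mp this) (by norm_num)

theorem eq_one_of_le {ν μ : ValuativeTree R} (h : ν ≤ μ) {x : R} (hx : x ∈ maximalIdeal R)
    (h1 : μ.1 x = 1) : ν.1 x = 1 :=
  le_antisymm (h1 ▸ h x) (ν.one_le hx)

end

/-- A parameter `x` at which `μ` attains its minimum on the maximal ideal can be completed to a
regular system of parameters. -/
theorem exists_parameters [IsRegularLocalRing R] (hdim : ringKrullDim R = 2)
    (μ : ValuativeTree R) : ∃ x y, μ.1 x = 1 ∧ maximalIdeal R = Ideal.span {x, y} ∧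
      (∀ n, ¬ x ∣ y ^ n) ∧ IsDomain R ∧ Prime x := by
  have hrank : (maximalIdeal R).spanFinrank = 2 := by
    have := IsRegularLocalRing.spanFinrank_maximalIdeal (R := R)
    rw [hdim] at this
    exact_mod_cast this
  have hht : 1 < (maximalIdeal R).height := by
    have := maximalIdeal_height_eq_ringKrullDim (R := R)
    rw [hdim] at this
    have h2 : (maximalIdeal R).height = 2 := WithBot.coe_injective this
    rw [h2]; norm_num
  obtain ⟨x, hxm, hx⟩ := μ.exists_eq_one
  obtain ⟨y, hm⟩ := exists_maximalIdeal_eq_span_pair hrank hxm (μ.notMem_sq hx)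
  have hy := not_dvd_pow_of_height hht hm
  have := isDomain_of_maximalIdeal_eq_span_pair hht hm
  refine ⟨x, y, hx, hm, hy, this, ?_⟩
  refine (Ideal.span_singleton_prime ?_).mp (isPrime_span_singleton hm hy)
  rintro rfl
  exact μ.notMem_sq hx (zero_mem _)

/-- The valuative tree has a least element, the order valuation. -/
theorem exists_isBot [IsRegularLocalRing R] (hdim : ringKrullDim R = 2)
    (μ : ValuativeTree R) : ∃ ν : ValuativeTree R, IsBot ν := by
  obtain ⟨x, y, h1, hm, hy, hdom, hx⟩ := exists_parameters hdim μ
  let ν : RealValuation R := (orderValuation hm hy hx).map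
    (AddMonoidHom.withTopMap (Nat.castAddMonoidHom ℝ)) rfl
    (WithTop.monotone_map_iff.mpr Nat.mono_cast)
  have hν : ∀ f, ν f = WithTop.map (Nat.cast : ℕ → ℝ) (maximalIdealOrder f) := fun _ => rfl
  have hle : ∀ {n : ℕ} {f : R}, f ∈ maximalIdeal R ^ n → (n : WithTop ℝ) ≤ ν f := by
    intro n f hf
    exact (WithTop.monotone_map_iff.mpr (Nat.mono_cast (α := ℝ)))
      (natCast_le_maximalIdealOrder_iff.mpr hf)
  have hle1 : ∀ f ∈ maximalIdeal R, 1 ≤ ν f := fun f hf => by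
    simpa using hle (n := 1) (by simpa using hf)
  have hxm : x ∈ maximalIdeal R := hm ▸ Ideal.subset_span (by simp)
  have hx1 : ν x = 1 := by
    rw [hν, maximalIdealOrder_eq_natCast (n := 1) (by simpa using hxm) (μ.notMem_sq h1)]
    exact congrArg WithTop.some Nat.cast_one
  refine ⟨⟨ν, ⟨fun f => by simpa using hle (n := 0) (f := f) (by simp), fun f hf =>
    zero_lt_one.trans_le (hle1 f hf)⟩, ⟨x, hxm, hx1⟩, ?_⟩, ?_⟩
  · rintro _ ⟨f, hf, rfl⟩
    exact hle1 f hf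
  · intro μ f
    change ν f ≤ μ.1 f
    have hμ : ∀ {n : ℕ}, f ∈ maximalIdeal R ^ n → (n : WithTop ℝ) ≤ μ.1 f :=
      RealValuation.natCast_le_of_mem_pow μ.zero_le (fun f hf => μ.one_le hf)
    rw [hν]
    cases hf : maximalIdealOrder f with
    | coe n => exact hμ (natCast_le_maximalIdealOrder_iff.mp hf.ge)
    | top =>
      cases h : μ.1 f with
      | top => exact le_top
      | coe r =>
        obtain ⟨n, hn⟩ := exists_nat_gt r
        have := hμ (natCast_le_maximalIdealOrder_iff.mp (hf.symm ▸ le_top : (n : ℕ∞) ≤ _))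
        rw [h] at this
        exact absurd (WithTop.coe_le_coe.mp this) hn.not_ge

end ValuativeTree

/-! ### Suprema of chains -/

theorem WithTop.add_le_of_isLUB_of_forall_add_le {s : Set (WithTop ℝ)} (hs : s.Nonempty)
    {a b c : WithTop ℝ} (ha : IsLUB s a) (h : ∀ t ∈ s, t + b ≤ c) : a + b ≤ c := by
  cases c with
  | top => exact le_top
  | coe c =>
    cases b with
    | top =>
      obtain ⟨t, ht⟩ := hs
      simpa using h t ht
    | coe b =>
      have hab : a ≤ ((c - b : ℝ) : WithTop ℝ) := by
        refine ha.2 fun t ht => ?_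
        have := h t ht
        cases t with
        | top => simp at this
        | coe t =>
          norm_cast at this ⊢
          linarith
      calc a + b ≤ ((c - b : ℝ) : WithTop ℝ) + b := by gcongr
        _ = c := by norm_cast; ring

namespace ValuativeTree

/-- A non-empty bounded above chain in the valuative tree has a least upper bound, computed
pointwise: on a chain the additive law for products passes to the pointwise supremum. -/
theorem exists_isLUB_of_isChain {R : Type*} [CommRing R] [IsLocalRing R]
    {L : Set (ValuativeTree R)} (hne : L.Nonempty) (hL : IsChain (· ≤ ·) L) (hb : BddAbove L) :
    ∃ ν : ValuativeTree R, IsLUB L ν := by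
  obtain ⟨μ, hμ⟩ := hb
  obtain ⟨ν₀, hν₀⟩ := hne
  let V : R → Set (WithTop ℝ) := fun f => (fun ν : ValuativeTree R => ν.1 f) '' L
  have hVne : ∀ f, (V f).Nonempty := fun f => ⟨_, ν₀, hν₀, rfl⟩
  let F : R → WithTop ℝ := fun f => sSup (V f)
  have hF : ∀ f, IsLUB (V f) (F f) := fun f => WithTop.isLUB_sSup' (hVne f)
  have le_F : ∀ {ν : ValuativeTree R}, ν ∈ L → ∀ f, ν.1 f ≤ F f :=
    fun hν f => (hF f).1 ⟨_, hν, rfl⟩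
  have F_le : ∀ {f : R} {c : WithTop ℝ}, (∀ ν ∈ L, ν.1 f ≤ c) → F f ≤ c := by
    intro f c h
    refine (hF f).2 ?_
    rintro _ ⟨ν, hν, rfl⟩
    exact h ν hν
  have F_mul : ∀ f g, F (f * g) = F f + F g := by
    intro f g
    apply le_antisymm
    · refine F_le fun ν hν => ?_
      rw [ν.1.map_mul]
      exact add_le_add (le_F hν f) (le_F hν g)
    · refine WithTop.add_le_of_isLUB_of_forall_add_le (hVne f) (hF f) ?_
      rintro _ ⟨ν, hν, rfl⟩
      rw [add_comm]
      refine WithTop.add_le_of_isLUB_of_forall_add_le (hVne g) (hF g) ?_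
      rintro _ ⟨ν', hν', rfl⟩
      dsimp only
      rcases hL.total hν hν' with h | h
      · calc ν'.1 g + ν.1 f ≤ ν'.1 g + ν'.1 f := by gcongr; exact h f
          _ = ν'.1 (f * g) := by rw [ν'.1.map_mul, add_comm]
          _ ≤ F (f * g) := le_F hν' _
      · calc ν'.1 g + ν.1 f ≤ ν.1 g + ν.1 f := by gcongr; exact h g
          _ = ν.1 (f * g) := by rw [ν.1.map_mul, add_comm]
          _ ≤ F (f * g) := le_F hν _
  have F_add : ∀ f g, min (F f) (F g) ≤ F (f + g) := by
    intro f g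
    by_contra! hlt
    obtain ⟨hf, hg⟩ := lt_min_iff.mp hlt
    obtain ⟨_, ⟨ν, hν, rfl⟩, hνf⟩ := (lt_isLUB_iff (hF f)).mp hf
    obtain ⟨_, ⟨ν', hν', rfl⟩, hνg⟩ := (lt_isLUB_iff (hF g)).mp hg
    dsimp only at hνf hνg
    rcases hL.total hν hν' with h | h
    · exact ((ν'.1.map_lt_add (hνf.trans_le (h f)) hνg).trans_le (le_F hν' _)).false
    · exact ((ν.1.map_lt_add hνf (hνg.trans_le (h g))).trans_le (le_F hν _)).false
  have hF0 : F 0 = ⊤ := top_le_iff.mp ((ν₀.1.map_zero).symm.trans_le (le_F hν₀ 0))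
  have hF1 : F 1 = 0 := le_antisymm (F_le fun ν _ => ν.1.map_one.le)
    ((ν₀.1.map_one).symm.trans_le (le_F hν₀ 1))
  have one_le_F : ∀ f ∈ maximalIdeal R, 1 ≤ F f := fun f hf => (ν₀.one_le hf).trans (le_F hν₀ f)
  obtain ⟨x, hxm, hx⟩ := μ.exists_eq_one
  have hFx : F x = 1 := le_antisymm (F_le fun ν hν => (hμ hν x).trans_eq hx) (one_le_F x hxm)
  refine ⟨⟨AddValuation.of F hF0 hF1 F_add F_mul,
    ⟨fun f => (ν₀.zero_le f).trans (le_F hν₀ f), fun f hf => zero_lt_one.trans_le (one_le_F f hf)⟩,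
    ⟨x, hxm, hFx⟩, ?_⟩, fun ν hν f => le_F hν f, fun ν hν f => F_le fun ν' hν' => hν hν' f⟩
  rintro _ ⟨f, hf, rfl⟩
  exact one_le_F f hf

/-! ### Lower bounds of a valuation form a chain -/

section

variable {R : Type*} [CommRing R] [IsLocalRing R] {x y : R}

/-- Approximate Weierstrass division by an element `φ` of residual order `d`: the remainder has
smaller residual order up to a power of `x`, or is divisible by `x ^ N`. -/
theorem exists_residual_division [IsNoetherianRing R] (hm : maximalIdeal R = Ideal.span {x, y})
    {d : ℕ} {φ : R} (hφ : HasResidualOrder x y d φ) (f : R) (N : ℕ) :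
    ∃ q r k, f = q * φ + x ^ k * r ∧ (k = N ∨ ∃ n < d, HasResidualOrder x y n r) := by
  induction N with
  | zero => exact ⟨0, f, 0, by ring, Or.inl rfl⟩
  | succ N ih =>
    obtain ⟨q, r, k, hf, rfl | hr⟩ := ih
    swap
    · exact ⟨q, r, k, hf, Or.inr hr⟩
    by_cases hxr : x ∣ r
    · obtain ⟨s, rfl⟩ := hxr
      exact ⟨q, s, k + 1, by rw [hf]; ring, Or.inl rfl⟩
    obtain ⟨n, hn⟩ := exists_hasResidualOrder hm hxr
    rcases lt_or_ge n d with hnd | hnd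
    · exact ⟨q, r, k, hf, Or.inr ⟨n, hnd, hn⟩⟩
    obtain ⟨u, -, z, rfl⟩ := hn
    obtain ⟨v, hv, w, rfl⟩ := hφ
    obtain ⟨v', hv'⟩ := hv.exists_left_inv
    obtain ⟨e, rfl⟩ := Nat.exists_eq_add_of_le hnd
    refine ⟨q + x ^ k * (u * v' * y ^ e), z - u * v' * y ^ e * w, k + 1, ?_, Or.inl rfl⟩
    rw [hf]
    linear_combination -x ^ k * u * y ^ (d + e) * hv'

theorem map_x_pow {ν : ValuativeTree R} (hx : ν.1 x = 1) (k : ℕ) : ν.1 (x ^ k) = k := by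
  rw [ν.1.map_pow, hx, nsmul_one]

/-- If `ν` and `μ` both take the value `1` at `x`, then an inequality between them already shows at
an element not divisible by `x`. -/
theorem exists_hasResidualOrder_lt [IsNoetherianRing R] (hm : maximalIdeal R = Ideal.span {x, y})
    {ν μ : ValuativeTree R} (hν : ν.1 x = 1) (hμ : μ.1 x = 1) {f : R} (hf : ν.1 f < μ.1 f) :
    ∃ n g, HasResidualOrder x y n g ∧ ν.1 g < μ.1 g := by
  by_contra! H
  -- Otherwise `x` could be divided out of `f` indefinitely, although `ν f` is finite.
  have step : ∀ k : ℕ, ∃ g, f = x ^ k * g ∧ ν.1 g < μ.1 g := by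
    intro k
    induction k with
    | zero => exact ⟨f, by ring, hf⟩
    | succ k ih =>
      obtain ⟨g, hg, hlt⟩ := ih
      have hxg : x ∣ g := by
        by_contra hxg
        obtain ⟨n, hn⟩ := exists_hasResidualOrder hm hxg
        exact (H n g hn).not_gt hlt
      obtain ⟨g, rfl⟩ := hxg
      refine ⟨g, by rw [hg]; ring, ?_⟩
      rw [ν.1.map_mul, μ.1.map_mul, hν, hμ] at hlt
      exact lt_of_add_lt_add_left hlt
  obtain ⟨r, hr⟩ := WithTop.ne_top_iff_exists.mp hf.ne_top
  obtain ⟨k, hk⟩ := exists_nat_gt r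
  obtain ⟨g, hg, -⟩ := step k
  have : (k : WithTop ℝ) ≤ ν.1 f := by
    rw [hg, ν.1.map_mul, map_x_pow hν]
    exact le_add_of_nonneg_right (ν.zero_le g)
  rw [← hr] at this
  exact hk.not_ge (WithTop.coe_le_coe.mp this)

/-- The property of key polynomials: if `ν ≤ μ` differ at `φ` and agree at `r`, then no
cancellation between a multiple of `φ` and `r` is visible to `ν`. -/
theorem map_le_map_of_eq_mul_add {ν μ : ValuativeTree R} (h : ν ≤ μ) {f q φ r : R}
    (hf : f = q * φ + r) (hφ : ν.1 φ < μ.1 φ) (hr : ν.1 r = μ.1 r) : ν.1 f ≤ ν.1 r := by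
  by_contra! hlt
  have hq : q * φ = f - r := by rw [hf]; ring
  have hqφ : ν.1 (q * φ) = ν.1 r := by rw [hq, ν.1.map_sub_eq_of_lt_right hlt]
  have hfin : ν.1 q ≠ ⊤ := by
    intro htop
    rw [ν.1.map_mul, htop, top_add] at hqφ
    exact hlt.ne_top hqφ.symm
  have hlt' : ν.1 r < μ.1 (q * φ) := by
    rw [← hqφ, ν.1.map_mul, μ.1.map_mul]
    exact (WithTop.add_lt_add_left hfin hφ).trans_le (add_le_add_left (h q) _)
  have hr' : r = f - q * φ := by rw [hf]; ring
  have : ν.1 r < μ.1 r := by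
    calc ν.1 r < min (μ.1 f) (μ.1 (q * φ)) := lt_min (hlt.trans_le (h f)) hlt'
      _ ≤ μ.1 (f - q * φ) := μ.1.map_sub _ _
      _ = μ.1 r := by rw [← hr']
  exact this.ne hr

/-- Let `φ` have the minimal residual order `d` among the elements at which `ν` or `ν'` differs from
their common upper bound `μ`. If `ν` differs from `μ` at `φ` and `ν φ ≤ ν' φ`, then `ν ≤ ν'`:
expand elements in powers of `φ` by repeated division. -/
theorem le_of_minimal_residualOrder [IsNoetherianRing R]
    (hm : maximalIdeal R = Ideal.span {x, y}) {ν ν' μ : ValuativeTree R} (h : ν ≤ μ)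
    (hν : ν.1 x = 1) (hν' : ν'.1 x = 1) (hμ : μ.1 x = 1) {d : ℕ} {φ : R}
    (hd : HasResidualOrder x y d φ) (hφ : ν.1 φ < μ.1 φ) (hφ' : ν.1 φ ≤ ν'.1 φ)
    (hmin : ∀ n < d, ∀ g, HasResidualOrder x y n g → ν.1 g = μ.1 g ∧ ν'.1 g = μ.1 g) :
    ν ≤ ν' := by
  have hφ1 : 1 ≤ ν.1 φ := by
    refine ν.one_le fun hu => hφ.ne ?_
    rw [ν.eq_zero_of_isUnit hu, μ.eq_zero_of_isUnit hu]
  have key : ∀ (n : ℕ) (f : R), min (ν.1 f) n ≤ ν'.1 f := by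
    intro n
    induction n with
    | zero => exact fun f => (min_le_right _ _).trans (by simpa using ν'.zero_le f)
    | succ n ih =>
      intro f
      obtain ⟨q, s, k, hf, hk⟩ := exists_residual_division hm hd f (n + 1)
      set r := x ^ k * s with hrdef
      have hr : min (ν.1 f) (n + 1 : ℕ) ≤ ν.1 r ∧ min (ν.1 f) (n + 1 : ℕ) ≤ ν'.1 r := by
        rcases hk with rfl | ⟨m, hmd, hs⟩
        · constructor
          · refine (min_le_right _ _).trans ?_
            rw [hrdef, ν.1.map_mul, map_x_pow hν]
            exact le_add_of_nonneg_right (ν.zero_le s)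
          · refine (min_le_right _ _).trans ?_
            rw [hrdef, ν'.1.map_mul, map_x_pow hν']
            exact le_add_of_nonneg_right (ν'.zero_le s)
        · obtain ⟨h1, h2⟩ := hmin m hmd s hs
          have e1 : ν.1 r = μ.1 r := by
            rw [hrdef, ν.1.map_mul, μ.1.map_mul, map_x_pow hν, map_x_pow hμ, h1]
          have e2 : ν'.1 r = ν.1 r := by
            rw [hrdef, ν'.1.map_mul, ν.1.map_mul, map_x_pow hν', map_x_pow hν, h1, h2]
          have := map_le_map_of_eq_mul_add h hf hφ e1
          exact ⟨(min_le_left _ _).trans this, e2 ▸ (min_le_left _ _).trans this⟩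
      have hq : min (ν.1 f) (n + 1 : ℕ) ≤ ν.1 q + ν.1 φ := by
        have hq : q * φ = f - r := by rw [hf]; ring
        rw [← ν.1.map_mul, hq]
        exact (le_min (min_le_left _ _) hr.1).trans (ν.1.map_sub f r)
      have hq' : min (ν.1 f) (n + 1 : ℕ) ≤ ν'.1 q + ν'.1 φ := by
        rcases le_total (ν.1 q) n with hqn | hqn
        · refine hq.trans (add_le_add ?_ hφ')
          simpa [min_eq_left hqn] using ih q
        · refine (min_le_right _ _).trans ?_
          rw [Nat.cast_add, Nat.cast_one]
          refine add_le_add ?_ (hφ1.trans hφ')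
          simpa [min_eq_right hqn] using ih q
      rw [← ν'.1.map_mul] at hq'
      rw [hf] at hq' hr ⊢
      exact ν'.1.map_le_add hq' hr.2
  intro f
  by_contra! hlt
  obtain ⟨r, hr⟩ := WithTop.ne_top_iff_exists.mp hlt.ne_top
  obtain ⟨n, hn⟩ := exists_nat_gt r
  refine (key n f).not_gt (lt_min hlt ?_)
  rw [← hr]
  exact WithTop.coe_lt_coe.mpr hn

end

/-- The tree property: two elements of the valuative tree with a common upper bound are
comparable. -/
theorem le_total_of_le {R : Type*} [CommRing R] [IsRegularLocalRing R] (hdim : ringKrullDim R = 2)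
    {ν₁ ν₂ μ : ValuativeTree R} (h₁ : ν₁ ≤ μ) (h₂ : ν₂ ≤ μ) : ν₁ ≤ ν₂ ∨ ν₂ ≤ ν₁ := by
  obtain ⟨x, y, hx, hm, -⟩ := exists_parameters hdim μ
  have hxm : x ∈ maximalIdeal R := hm ▸ Ideal.subset_span (by simp)
  let P : ValuativeTree R → ℕ → Prop := fun ν n => ∃ g, HasResidualOrder x y n g ∧ ν.1 g < μ.1 g
  have compare : ∀ {ν ν' : ValuativeTree R} {d : ℕ}, ν ≤ μ → ν' ≤ μ → P ν d →
      (∀ n < d, ¬ P ν n ∧ ¬ P ν' n) → ν ≤ ν' ∨ ν' ≤ ν := by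
    intro ν ν' d h h' hP hmin
    obtain ⟨φ, hd, hφ⟩ := hP
    have hν := eq_one_of_le h hxm hx
    have hν' := eq_one_of_le h' hxm hx
    have hmin' : ∀ n < d, ∀ g, HasResidualOrder x y n g → ν.1 g = μ.1 g ∧ ν'.1 g = μ.1 g :=
      fun n hn g hg => ⟨eq_of_le_of_not_lt (h g) fun hlt => (hmin n hn).1 ⟨g, hg, hlt⟩,
        eq_of_le_of_not_lt (h' g) fun hlt => (hmin n hn).2 ⟨g, hg, hlt⟩⟩
    rcases le_or_gt (ν.1 φ) (ν'.1 φ) with hle | hlt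
    · exact Or.inl (le_of_minimal_residualOrder hm h hν hν' hx hd hφ hle hmin')
    -- Here `ν' φ < ν φ < μ φ`, so `φ` is also of minimal residual order for `ν'`.
    · exact Or.inr (le_of_minimal_residualOrder hm h' hν' hν hx hd (hlt.trans hφ) hlt.le
        fun n hn g hg => (hmin' n hn g hg).symm)
  by_cases hP : ∃ n, P ν₁ n ∨ P ν₂ n
  · classical
    have hmin : ∀ n < Nat.find hP, ¬ P ν₁ n ∧ ¬ P ν₂ n := fun n hn =>
      not_or.mp (Nat.find_min hP hn)
    rcases Nat.find_spec hP with h | h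
    · exact compare h₁ h₂ h hmin
    · exact (compare h₂ h₁ h fun n hn => (hmin n hn).symm).symm
  · refine Or.inr fun f => (h₂ f).trans ?_
    by_contra! hlt
    obtain ⟨n, hn⟩ := exists_hasResidualOrder_lt hm (eq_one_of_le h₁ hxm hx) hx hlt
    exact hP ⟨n, Or.inl hn⟩

end ValuativeTree

/-- Every non-empty subset of the valuative tree of a two-dimensional regular local ring has an
infimum in the valuative tree. -/
theorem theorem1p1 (R : Type*) [CommRing R] [IsRegularLocalRing R] (hdim : ringKrullDim R = 2)
    (S : Set (ValuativeTree R)) (hS : S.Nonempty) :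
    ∃ ν : ValuativeTree R, IsGLB S ν := by
  obtain ⟨μ, hμ⟩ := hS
  obtain ⟨b, hb⟩ := ValuativeTree.exists_isBot hdim μ
  obtain ⟨ν, hν⟩ := ValuativeTree.exists_isLUB_of_isChain (L := lowerBounds S)
    ⟨b, fun ν _ => hb ν⟩
    (fun ν₁ h₁ ν₂ h₂ _ => ValuativeTree.le_total_of_le hdim (h₁ hμ) (h₂ hμ))
    ⟨μ, fun ν hν => hν hμ⟩
  exact ⟨ν, isLUB_lowerBounds.mp hν⟩
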